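/- Let $\mathbf{TR} = 0102010\cdots$ be the infinite Tribonacci word, i.e., the fixed point of the morphism $0 \mapsto 01$, $1 \mapsto 02$, $2 \mapsto 0$, indexed from position $0$, and let $\mathbf{TR}[0..n-1]$ denote its prefix of length $n$. A string attractor of a finite word $w = w[0..n-1]$ is a set $S \subseteq \{0,1,\ldots,n-1\}$ such that every nonempty factor of $w$ has an occurrence in $w$ that touches an index of $S$. Let $T_0 = 0$, $T_1 = T_2 = 1$, and $T_n = T_{n-1}+T_{n-2}+T_{n-3}$ for $n \geq 3$, and let $$W_n = T_n + T_{n-3} + T_{n-6} + \cdots + T_{2+((n-2) \bmod 3)} \qquad (n \geq 4).$$ Then for every $n \geq 4$ the minimum cardinality of a string attractor of $\mathbf{TR}[0..n-1]$ is $3$. Furthermore, for all $i \geq 4$ and all $n$ with $W_i \leq n < W_{i+1}$, the set $\{T_{i-2}-1,\ T_{i-1}-1,\ T_i-1\}$ has three elements and is a string attractor of $\mathbf{TR}[0..n-1]$ of minimum cardinality. -/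

import Mathlib

/-- `S` is a string attractor of the finite word `w` (indexed from `0`): `S ⊆ {0, …, |w| - 1}`, and
every nonempty factor `f` of `w` has an occurrence in `w`, starting at some position `r`, that
touches an index of `S`. -/
def IsStringAttractor {α : Type*} (w : List α) (S : Finset ℕ) : Prop :=
  (∀ s ∈ S, s < w.length) ∧
    ∀ f : List α, f ≠ [] → f <:+: w →
      ∃ r : ℕ, f <+: w.drop r ∧ ∃ s ∈ S, r ≤ s ∧ s < r + f.length

/-- `S` is a string attractor of `w` of minimum cardinality. -/
def IsSmallestStringAttractor {α : Type*} (w : List α) (S : Finset ℕ) : Prop :=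
  IsStringAttractor w S ∧ ∀ S' : Finset ℕ, IsStringAttractor w S' → S.card ≤ S'.card

/-- The morphism `0 ↦ 01`, `1 ↦ 02`, `2 ↦ 0`, on letters. -/
def tribMorphism : Fin 3 → List (Fin 3)
  | 0 => [0, 1]
  | 1 => [0, 2]
  | 2 => [0]

/-- The `n`-th iterate of the Tribonacci morphism on the one-letter word `0`. -/
def tribIterate : ℕ → List (Fin 3)
  | 0 => [0]
  | n + 1 => (tribIterate n).flatMap tribMorphism

theorem zero_mem_tribIterate (n : ℕ) : (0 : Fin 3) ∈ tribIterate n := by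
  induction n with
  | zero => simp [tribIterate]
  | succ n ih => exact List.mem_flatMap.2 ⟨0, ih, by simp [tribMorphism]⟩

theorem length_le_length_flatMap_tribMorphism (l : List (Fin 3)) :
    l.length ≤ (l.flatMap tribMorphism).length := by
  induction l with
  | nil => simp
  | cons a l ih =>
    have : 1 ≤ (tribMorphism a).length := by fin_cases a <;> simp [tribMorphism]
    simp only [List.flatMap_cons, List.length_append, List.length_cons]
    omega

theorem length_lt_length_flatMap_tribMorphism (l : List (Fin 3)) (h : 0 ∈ l) :
    l.length < (l.flatMap tribMorphism).length := by
  obtain ⟨s, t, rfl⟩ := List.append_of_mem h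
  have h1 := length_le_length_flatMap_tribMorphism s
  have h2 := length_le_length_flatMap_tribMorphism t
  have h3 : (tribMorphism 0).length = 2 := rfl
  simp only [List.flatMap_append, List.flatMap_cons, List.length_append, List.length_cons]
  omega

theorem lt_length_tribIterate (n : ℕ) : n < (tribIterate n).length := by
  induction n with
  | zero => simp [tribIterate]
  | succ n ih =>
    have := length_lt_length_flatMap_tribMorphism _ (zero_mem_tribIterate n)
    simp only [tribIterate]
    omega

/-- The infinite Tribonacci word `0102010…`, the fixed point of the morphism, as the limit of the
iterates of the morphism on `0` (each iterate is a prefix of the next). -/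
def tribWord (n : ℕ) : Fin 3 :=
  (tribIterate n)[n]'(lt_length_tribIterate n)

/-- The length-`n` prefix of the Tribonacci word. -/
def tribPrefix (n : ℕ) : List (Fin 3) :=
  (List.range n).map tribWord

theorem tribIterate_prefix_succ (n : ℕ) : tribIterate n <+: tribIterate (n + 1) := by
  induction n with
  | zero => exact ⟨[1], rfl⟩
  | succ n ih =>
    obtain ⟨t, ht⟩ := ih
    refine ⟨t.flatMap tribMorphism, ?_⟩
    rw [show tribIterate (n + 1 + 1) = (tribIterate (n + 1)).flatMap tribMorphism from rfl, ← ht,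
      List.flatMap_append, ht]
    rfl

theorem tribIterate_prefix {m n : ℕ} (h : m ≤ n) : tribIterate m <+: tribIterate n := by
  induction n, h using Nat.le_induction with
  | base => exact List.prefix_refl _
  | succ n _ ih => exact ih.trans (tribIterate_prefix_succ n)

theorem tribWord_eq {m k : ℕ} (h : k < (tribIterate m).length) :
    tribWord k = (tribIterate m)[k] := by
  unfold tribWord
  rcases le_total k m with hk | hk
  · exact (tribIterate_prefix hk).getElem _
  · exact ((tribIterate_prefix hk).getElem _).symm

theorem tribPrefix_eq_take {m n : ℕ} (h : n ≤ (tribIterate m).length) :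
    tribPrefix n = (tribIterate m).take n := by
  apply List.ext_getElem
  · simp [tribPrefix, h]
  · intro i h1 h2
    have hi : i < n := by simpa [tribPrefix] using h1
    simp [tribPrefix, tribWord_eq (lt_of_lt_of_le hi h)]

/-- The Tribonacci word is fixed by the morphism: the image of each prefix is again a prefix. -/
theorem tribPrefix_flatMap (n : ℕ) :
    (tribPrefix n).flatMap tribMorphism =
      tribPrefix ((tribPrefix n).flatMap tribMorphism).length := by
  have h : tribPrefix n <+: tribIterate n := by
    rw [tribPrefix_eq_take (lt_length_tribIterate n).le]
    exact List.take_prefix _ _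
  obtain ⟨t, ht⟩ := h
  have h' : (tribPrefix n).flatMap tribMorphism <+: tribIterate (n + 1) :=
    ⟨t.flatMap tribMorphism, by rw [← List.flatMap_append, ht]; rfl⟩
  rw [tribPrefix_eq_take h'.length_le]
  exact List.prefix_iff_eq_take.1 h'

/-- The Tribonacci numbers `T 0 = 0`, `T 1 = T 2 = 1`, `T n = T (n-1) + T (n-2) + T (n-3)`. -/
def tribT : ℕ → ℕ
  | 0 => 0
  | 1 => 1
  | 2 => 1
  | n + 3 => tribT (n + 2) + tribT (n + 1) + tribT n

/-- `W n = T n + T (n-3) + T (n-6) + ⋯ + T (2 + ((n-2) mod 3))`; meaningful for `n ≥ 2`, and used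
only for `n ≥ 4`. -/
def tribW (n : ℕ) : ℕ :=
  ∑ j ∈ Finset.range ((n - 2) / 3 + 1), tribT (n - 3 * j)

/-! Write `h k` for the iterates, of length `T (k+2)`. The factorisation `h (k+3) = h (k+2) ++ h
(k+1) ++ h k` makes prefixes recur at sums of consecutive `T`'s, and hence gives the prefix of
length `W (m+1) - 1` the period `T m` (`tribWord_period`). The attractor property
(`hasTouchingOccurrence`) follows by induction on the level. A factor right of one of the two
largest indices moves left by a period until it touches an index or ends early. A factor ending
early is covered by the previous level; if it touches only the index dropped there, translation
carries that index to the new one. Minimality holds because each of the three letters needs its own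
position. -/

/-! ### Recursive structure; the numbers `T` and `W` -/

theorem tribIterate_add_three (k : ℕ) :
    tribIterate (k + 3) = tribIterate (k + 2) ++ tribIterate (k + 1) ++ tribIterate k := by
  induction k with
  | zero => rfl
  | succ k ih =>
    change (tribIterate (k + 3)).flatMap tribMorphism = _
    conv_lhs => rw [ih, List.flatMap_append, List.flatMap_append]
    rfl

theorem tribT_add_three (k : ℕ) : tribT (k + 3) = tribT (k + 2) + tribT (k + 1) + tribT k := rfl

theorem length_tribIterate (k : ℕ) : (tribIterate k).length = tribT (k + 2) := by
  induction k using Nat.strong_induction_on with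
  | _ k ih =>
    match k with
    | 0 => rfl
    | 1 => rfl
    | 2 => rfl
    | k + 3 =>
      rw [tribIterate_add_three, List.length_append, List.length_append, ih _ (by omega),
        ih _ (by omega), ih _ (by omega), tribT_add_three (k + 2)]

theorem tribT_pos (k : ℕ) : 1 ≤ tribT (k + 1) := by
  induction k using Nat.strong_induction_on with
  | _ k ih =>
    match k with
    | 0 => exact le_rfl
    | 1 => exact le_rfl
    | k + 2 =>
      have := ih k (by omega)
      rw [show k + 2 + 1 = k + 3 from rfl, tribT_add_three]
      omega

theorem tribT_lt (k : ℕ) : tribT (k + 2) < tribT (k + 3) := by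
  rw [tribT_add_three]
  have := tribT_pos k
  omega

theorem tribT_succ_le_two_mul (k : ℕ) : tribT (k + 3) ≤ 2 * tribT (k + 2) := by
  match k with
  | 0 => decide
  | k + 1 =>
    have h1 := tribT_add_three (k + 1)
    have h2 := tribT_add_three k
    change tribT (k + 4) ≤ 2 * tribT (k + 3)
    change tribT (k + 4) = tribT (k + 3) + tribT (k + 2) + tribT (k + 1) at h1
    omega

theorem tribW_add_three (k : ℕ) : tribW (k + 5) = tribT (k + 5) + tribW (k + 2) := by
  unfold tribW
  rw [show (k + 5 - 2) / 3 + 1 = (k + 2 - 2) / 3 + 1 + 1 by omega, Finset.sum_range_succ', add_comm]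
  congr 1
  refine Finset.sum_congr rfl fun j _ => ?_
  congr 1
  omega

theorem tribT_le_tribW (k : ℕ) : tribT k ≤ tribW k := by
  unfold tribW
  rw [Finset.sum_range_succ']
  exact Nat.le_add_left _ _

theorem tribW_lt_tribT_succ (k : ℕ) : tribW (k + 2) < tribT (k + 3) := by
  induction k using Nat.strong_induction_on with
  | _ k ih =>
    match k with
    | 0 => decide
    | 1 => decide
    | 2 => decide
    | k + 3 =>
      have h1 := ih k (by omega)
      have h2 := tribW_add_three k
      have h3 := tribT_add_three (k + 3)
      change tribW (k + 5) < tribT (k + 6)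
      change tribT (k + 6) = tribT (k + 5) + tribT (k + 4) + tribT (k + 3) at h3
      omega

/-! ### Recurring prefixes and periods -/

theorem tribWord_tribT_add {k j : ℕ} (hj : j < tribT (k + 2)) :
    tribWord (tribT (k + 3) + j) = tribWord j := by
  match k with
  | 0 =>
    obtain rfl : j = 0 := by
      change j < 1 at hj
      omega
    rfl
  | k + 1 =>
    have h2 := length_tribIterate (k + 2)
    have h1 := length_tribIterate (k + 1)
    change _ = tribT (k + 4) at h2
    change _ = tribT (k + 3) at h1
    change j < tribT (k + 3) at hj
    change tribWord (tribT (k + 4) + j) = _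
    rw [tribWord_eq (m := k + 1) (k := j) (by omega),
      tribWord_eq (m := k + 3) (by simp [tribIterate_add_three]; omega)]
    simp [tribIterate_add_three, h1, h2, hj]

theorem tribWord_tribT_add_tribT_add {k j : ℕ} (hj : j < tribT (k + 2)) :
    tribWord (tribT (k + 4) + tribT (k + 3) + j) = tribWord j := by
  have h2 := length_tribIterate (k + 2)
  have h1 := length_tribIterate (k + 1)
  have h0 := length_tribIterate k
  change _ = tribT (k + 4) at h2
  change _ = tribT (k + 3) at h1
  rw [tribWord_eq (m := k) (k := j) (by omega),
    tribWord_eq (m := k + 3) (by simp [tribIterate_add_three]; omega)]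
  simp only [tribIterate_add_three, List.append_assoc]
  rw [List.getElem_append_right (by omega), List.getElem_append_right (by omega)]
  congr 1
  omega

/-- The prefix of length `W (m + 1) - 1` of the Tribonacci word has period `T m`. -/
theorem tribWord_period (m j : ℕ) (hj : tribT m + j + 2 ≤ tribW (m + 1)) :
    tribWord (tribT m + j) = tribWord j := by
  induction m using Nat.strong_induction_on generalizing j with
  | _ m ih =>
    match m with
    | 0 => simp [tribT]
    | 1 =>
      have : tribW 2 = 1 := by decide
      simp only [Nat.reduceAdd] at hj
      omega
    | 2 =>
      have : tribW 3 = 2 := by decide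
      have : tribT 2 = 1 := rfl
      simp only [Nat.reduceAdd] at hj
      omega
    | 3 =>
      have : tribW 4 = 4 := by decide
      have h3 : tribT 3 = 2 := rfl
      simp only [Nat.reduceAdd] at hj
      obtain rfl : j = 0 := by omega
      rfl
    | k + 4 =>
      have eW := tribW_add_three k
      have e5 : tribT (k + 5) = tribT (k + 4) + tribT (k + 3) + tribT (k + 2) := rfl
      have e4 : tribT (k + 4) = tribT (k + 3) + tribT (k + 2) + tribT (k + 1) := rfl
      have bW := tribW_lt_tribT_succ k
      change tribT (k + 4) + j + 2 ≤ tribW (k + 5) at hj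
      rcases lt_or_ge j (tribT (k + 3)) with h | h
      · exact tribWord_tribT_add (k := k + 1) h
      obtain ⟨j, rfl⟩ := Nat.exists_eq_add_of_le h
      rcases lt_or_ge j (tribT (k + 2)) with h' | h'
      · rw [← add_assoc, tribWord_tribT_add_tribT_add h', tribWord_tribT_add h']
      obtain ⟨j, rfl⟩ := Nat.exists_eq_add_of_le h'
      have e : tribWord (tribT (k + 4) + (tribT (k + 3) + (tribT (k + 2) + j))) = tribWord j := by
        rw [← add_assoc, ← add_assoc, ← e5]
        exact tribWord_tribT_add (k := k + 2) (by change j < tribT (k + 4); omega)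
      rw [e]
      -- Past `T (k+5)` two prefix positions remain to be compared. For `k = 0` the bound `W 5 = T 5
      -- + 1` leaves none.
      match k with
      | 0 =>
        have : tribW (0 + 2) = 1 := by decide
        omega
      | k + 1 =>
        change tribWord j = tribWord (tribT (k + 4) + (tribT (k + 3) + j))
        rw [← add_assoc]
        rcases lt_or_ge j (tribT (k + 2)) with h3 | h3
        · rw [tribWord_tribT_add_tribT_add h3]
        obtain ⟨j, rfl⟩ := Nat.exists_eq_add_of_le h3
        have e5' : tribT (k + 5) = tribT (k + 4) + tribT (k + 3) + tribT (k + 2) := rfl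
        change tribW (k + 6) = tribT (k + 6) + tribW (k + 3) at eW
        change tribW (k + 3) < tribT (k + 4) at bW
        change _ + 2 ≤ tribW (k + 6) at hj
        change tribT (k + 6) = tribT (k + 5) + tribT (k + 4) + tribT (k + 3) at e5
        change tribT (k + 5) + (tribT (k + 4) + (tribT (k + 3) + (tribT (k + 2) + j))) + 2 ≤ _ at hj
        rw [← add_assoc, ← e5', tribWord_tribT_add (k := k + 2) (by change j < tribT (k + 4); omega)]
        -- What remains is the period three levels down, matching `W (k+6) = T (k+6) + W (k+3)`.
        exact ih (k + 2) (by omega) j (by change _ ≤ tribW (k + 3); omega)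

/-- The copy of `h k` found at this position ends at `T (k+5)`, where the prefix starts afresh; the
period `T (k+2)` makes this restart continue the copy. -/
theorem tribWord_shift {k j : ℕ} (hj : j + 2 ≤ tribT (k + 3)) :
    tribWord (tribT (k + 4) + tribT (k + 3) + j) = tribWord j := by
  rcases lt_or_ge j (tribT (k + 2)) with h | h
  · exact tribWord_tribT_add_tribT_add h
  obtain ⟨j, rfl⟩ := Nat.exists_eq_add_of_le h
  have e5 : tribT (k + 5) = tribT (k + 4) + tribT (k + 3) + tribT (k + 2) := rfl
  have e4 : tribT (k + 4) = tribT (k + 3) + tribT (k + 2) + tribT (k + 1) := rfl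
  have := tribT_le_tribW (k + 3)
  rw [← add_assoc, ← e5, tribWord_tribT_add (k := k + 2) (by change j < tribT (k + 4); omega),
    tribWord_period (k + 2) j (by change _ ≤ tribW (k + 3); omega)]

/-- The factor of length `e + 1` at position `p` of the Tribonacci word has an occurrence inside the
prefix of length `n` that touches an index among `T i - 1`, `T (i + 1) - 1`, `T (i + 2) - 1`. -/
def HasTouchingOccurrence (i n p e : ℕ) : Prop :=
  ∃ r, (∀ j ≤ e, tribWord (r + j) = tribWord (p + j)) ∧ r + e < n ∧
    ∃ s, (s = tribT i - 1 ∨ s = tribT (i + 1) - 1 ∨ s = tribT (i + 2) - 1) ∧ r ≤ s ∧ s ≤ r + e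

theorem HasTouchingOccurrence.of_eq {i n p p' e : ℕ}
    (h : ∀ j ≤ e, tribWord (p' + j) = tribWord (p + j)) (H : HasTouchingOccurrence i n p' e) :
    HasTouchingOccurrence i n p e := by
  obtain ⟨r, h1, h2⟩ := H
  exact ⟨r, fun j hj => (h1 j hj).trans (h j hj), h2⟩

theorem hasTouchingOccurrence (i n p e : ℕ) (hn : tribW (i + 3) ≤ n) (hn' : n < tribW (i + 4))
    (hpe : p + e < n) : HasTouchingOccurrence (i + 1) n p e := by
  induction i generalizing n p e with
  | zero =>
    have h4 : tribW (0 + 4) = 4 := by decide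
    rcases lt_or_ge p 2 with hp | hp
    · refine ⟨p, fun _ _ => rfl, hpe, p, ?_, le_rfl, Nat.le_add_right _ _⟩
      change p = 0 ∨ p = 0 ∨ p = 1
      omega
    · obtain ⟨rfl, rfl⟩ : p = 2 ∧ e = 0 := by omega
      refine ⟨0, fun j hj => ?_, by omega, 0, Or.inl rfl, le_rfl, le_rfl⟩
      obtain rfl : j = 0 := by omega
      rfl
  | succ i ih =>
    change tribW (i + 4) ≤ n at hn
    change n < tribW (i + 5) at hn'
    change HasTouchingOccurrence (i + 2) n p e
    have e4 : tribT (i + 4) = tribT (i + 3) + tribT (i + 2) + tribT (i + 1) := rfl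
    have b3 := tribW_lt_tribT_succ (i + 1)
    have w3 := tribT_le_tribW (i + 3)
    have w4 := tribT_le_tribW (i + 4)
    have p3 := tribT_pos (i + 2)
    change 1 ≤ tribT (i + 3) at p3
    change tribW (i + 3) < tribT (i + 4) at b3
    induction p using Nat.strong_induction_on with
    | _ p ihp =>
    rcases lt_or_ge (p + e) (tribW (i + 3)) with hq | hq
    -- The least length at the previous level already contains the factor.
    · obtain ⟨r, hr, hrn, s, hs, hrs, hse⟩ := ih (tribW (i + 3)) p e le_rfl (by omega) hq
      change s = tribT (i + 1) - 1 ∨ s = tribT (i + 2) - 1 ∨ s = tribT (i + 3) - 1 at hs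
      by_cases h2 : r ≤ tribT (i + 2) - 1 ∧ tribT (i + 2) - 1 ≤ r + e
      · exact ⟨r, hr, by omega, _, Or.inl rfl, h2⟩
      by_cases h3 : r ≤ tribT (i + 3) - 1 ∧ tribT (i + 3) - 1 ≤ r + e
      · exact ⟨r, hr, by omega, _, Or.inr (Or.inl rfl), h3⟩
      obtain rfl : s = tribT (i + 1) - 1 := by
        rcases hs with h | h | h
        · exact h
        · subst h; omega
        · subst h; omega
      match i with
      -- Here `T 1 = T 2`, so no index is dropped.
      | 0 => exact absurd ⟨hrs, hse⟩ h2
      | k + 1 =>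
        have lt := tribT_lt k
        have e5 : tribT (k + 5) = tribT (k + 4) + tribT (k + 3) + tribT (k + 2) := rfl
        have e4' : tribT (k + 4) = tribT (k + 3) + tribT (k + 2) + tribT (k + 1) := rfl
        have dbl := tribT_succ_le_two_mul k
        have wk := tribT_le_tribW (k + 2)
        have eW := tribW_add_three k
        have p2 := tribT_pos (k + 1)
        change tribW (k + 5) ≤ n at hn
        change ¬ (r ≤ tribT (k + 3) - 1 ∧ tribT (k + 3) - 1 ≤ r + e) at h2
        change r ≤ tribT (k + 2) - 1 at hrs
        change tribT (k + 2) - 1 ≤ r + e at hse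
        change 1 ≤ tribT (k + 2) at p2
        -- This translation sends the dropped index `T (k+2) - 1` to `T (k+5) - 1`. Missing `T (k+3)
        -- - 1` forces `r + e + 2 ≤ T (k+3)`, exactly the range of `tribWord_shift`.
        refine ⟨tribT (k + 4) + tribT (k + 3) + r, fun j hj => ?_, by omega, tribT (k + 5) - 1,
          Or.inr (Or.inr rfl), by omega, by omega⟩
        rw [add_assoc, tribWord_shift (by omega), hr j hj]
    · by_cases h3 : p ≤ tribT (i + 3) - 1
      · refine ⟨p, fun _ _ => rfl, hpe, _, Or.inr (Or.inl rfl), h3, ?_⟩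
        change tribT (i + 3) - 1 ≤ _
        omega
      by_cases h4 : p ≤ tribT (i + 4) - 1 ∧ tribT (i + 4) - 1 ≤ p + e
      · exact ⟨p, fun _ _ => rfl, hpe, _, Or.inr (Or.inr rfl), h4⟩
      -- The factor lies strictly between the two largest indices, or beyond both; the period is `T
      -- (i+3)` or `T (i+4)` accordingly. The second case needs `n < W (i+5)`.
      rcases lt_or_ge p (tribT (i + 4)) with h5 | h5
      · obtain ⟨p, rfl⟩ := Nat.exists_eq_add_of_le (show tribT (i + 3) ≤ p by omega)
        refine (ihp p (by omega) (by omega)).of_eq fun j hj => ?_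
        rw [add_assoc, tribWord_period (i + 3) _ (by change _ ≤ tribW (i + 4); omega)]
      · obtain ⟨p, rfl⟩ := Nat.exists_eq_add_of_le h5
        refine (ihp p (by omega) (by omega)).of_eq fun j hj => ?_
        rw [add_assoc, tribWord_period (i + 4) _ (by change _ ≤ tribW (i + 5); omega)]

/-! ### String attractors and minimality -/

theorem length_tribPrefix (n : ℕ) : (tribPrefix n).length = n := by simp [tribPrefix]

theorem getElem_tribPrefix {n k : ℕ} (h : k < (tribPrefix n).length) :
    (tribPrefix n)[k] = tribWord k := by simp [tribPrefix]

theorem isStringAttractor_tribPrefix (i n : ℕ) (hn : tribW (i + 4) ≤ n) (hn' : n < tribW (i + 5)) :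
    IsStringAttractor (tribPrefix n)
      {tribT (i + 2) - 1, tribT (i + 3) - 1, tribT (i + 4) - 1} := by
  have l2 := tribT_lt i
  have l3 := tribT_lt (i + 1)
  have w4 := tribT_le_tribW (i + 4)
  change tribT (i + 3) < tribT (i + 4) at l3
  refine ⟨fun s hs => ?_, fun f hf hfw => ?_⟩
  · rw [length_tribPrefix]
    simp only [Finset.mem_insert, Finset.mem_singleton] at hs
    omega
  · obtain ⟨u, v, huv⟩ := hfw
    have hlen := congrArg List.length huv
    simp only [List.length_append, length_tribPrefix] at hlen
    have hpos := List.length_pos_iff.2 hf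
    obtain ⟨r, hr, hrn, s, hs, hrs, hse⟩ := hasTouchingOccurrence (i + 1) n u.length (f.length - 1)
      hn hn' (by omega)
    refine ⟨r, ?_, s, by simpa only [Finset.mem_insert, Finset.mem_singleton] using hs, hrs, by omega⟩
    rw [List.prefix_iff_eq_take]
    apply List.ext_getElem
    · simp only [List.length_take, List.length_drop, length_tribPrefix]
      omega
    · intro j hj _
      rw [List.getElem_take, List.getElem_drop, getElem_tribPrefix, hr j (by omega),
        ← getElem_tribPrefix (n := n) (by rw [length_tribPrefix]; omega)]
      simp [← huv, hj]

/-- A string attractor of a prefix containing all three letters has at least three elements. -/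
theorem three_le_card_of_isStringAttractor {n : ℕ} (hn : 4 ≤ n) {S : Finset ℕ}
    (hS : IsStringAttractor (tribPrefix n) S) : 3 ≤ S.card := by
  have key : ∀ a : Fin 3, a ∈ S.image tribWord := by
    intro a
    have ha : a ∈ tribPrefix n := by
      obtain ⟨k, hk, rfl⟩ : ∃ k < 4, tribWord k = a := by
        fin_cases a
        exacts [⟨0, by decide, rfl⟩, ⟨1, by decide, rfl⟩, ⟨3, by decide, rfl⟩]
      exact List.mem_map.2 ⟨k, List.mem_range.2 (by omega), rfl⟩
    obtain ⟨u, v, huv⟩ := List.append_of_mem ha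
    obtain ⟨r, hr, s, hs, hrs, hsr⟩ := hS.2 [a] (by simp) ⟨u, v, by simp [huv]⟩
    obtain rfl : s = r := by
      simp only [List.length_singleton] at hsr
      omega
    obtain ⟨t, ht⟩ := hr
    have hsn := hS.1 s hs
    have h0 : ((tribPrefix n).drop s)[0]'(by simp; omega) = a := by simp [← ht]
    rw [List.getElem_drop, getElem_tribPrefix] at h0
    exact Finset.mem_image.2 ⟨s, hs, by simpa using h0⟩
  calc 3 = (Finset.univ : Finset (Fin 3)).card := rfl
    _ ≤ (S.image tribWord).card := Finset.card_le_card fun a _ => key a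
    _ ≤ S.card := Finset.card_image_le

theorem card_tribT_triple (i : ℕ) :
    ({tribT (i + 2) - 1, tribT (i + 3) - 1, tribT (i + 4) - 1} : Finset ℕ).card = 3 := by
  have p2 := tribT_pos (i + 1)
  have l2 := tribT_lt i
  have l3 := tribT_lt (i + 1)
  change 1 ≤ tribT (i + 2) at p2
  change tribT (i + 3) < tribT (i + 4) at l3
  exact Finset.card_eq_three.2 ⟨_, _, _, by omega, by omega, by omega, rfl⟩

theorem exists_tribW_le_lt {n : ℕ} (hn : 4 ≤ n) :
    ∃ i, tribW (i + 4) ≤ n ∧ n < tribW (i + 5) := by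
  -- Unboundedness of `W`, from `W k < T (k+1) ≤ W (k+1)`.
  have mono : ∀ k, k < tribW (k + 4) := by
    intro k
    induction k with
    | zero => decide
    | succ k ih =>
      have h1 := tribW_lt_tribT_succ (k + 2)
      have h2 := tribT_le_tribW (k + 5)
      change tribW (k + 4) < tribT (k + 5) at h1
      change k + 1 < tribW (k + 5)
      omega
  have hex : ∃ i, n < tribW (i + 4) := ⟨n, mono n⟩
  have h4 : tribW (0 + 4) = 4 := by decide
  classical
  obtain ⟨m, hm⟩ : ∃ m, Nat.find hex = m + 1 := Nat.exists_eq_succ_of_ne_zero fun h => by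
    have := Nat.find_spec hex
    rw [h] at this
    omega
  refine ⟨m, not_lt.1 (Nat.find_min hex (by omega)), ?_⟩
  have := Nat.find_spec hex
  rwa [hm] at this

theorem theorem6 :
    (∀ n : ℕ, 4 ≤ n →
      IsLeast {k : ℕ | ∃ S : Finset ℕ, IsStringAttractor (tribPrefix n) S ∧ S.card = k} 3) ∧
    (∀ i n : ℕ, 4 ≤ i → tribW i ≤ n → n < tribW (i + 1) →
      ({tribT (i - 2) - 1, tribT (i - 1) - 1, tribT i - 1} : Finset ℕ).card = 3 ∧
      IsSmallestStringAttractor (tribPrefix n)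
        {tribT (i - 2) - 1, tribT (i - 1) - 1, tribT i - 1}) := by
  refine ⟨fun n hn => ⟨?_, ?_⟩, fun i n hi h1 h2 => ?_⟩
  · obtain ⟨i, h1, h2⟩ := exists_tribW_le_lt hn
    exact ⟨_, isStringAttractor_tribPrefix i n h1 h2, card_tribT_triple i⟩
  · rintro k ⟨S, hS, rfl⟩
    exact three_le_card_of_isStringAttractor hn hS
  · obtain ⟨i, rfl⟩ := Nat.exists_eq_add_of_le' hi
    have hn : 4 ≤ n := by
      have hmono : ∀ k, 4 ≤ tribT (k + 4) := by
        intro k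
        induction k with
        | zero => decide
        | succ k ih => exact ih.trans (tribT_lt (k + 2)).le
      exact (hmono i).trans ((tribT_le_tribW _).trans h1)
    refine ⟨card_tribT_triple i, isStringAttractor_tribPrefix i n h1 h2, fun S hS => ?_⟩
    exact (card_tribT_triple i).trans_le (three_le_card_of_isStringAttractor hn hS)
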